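/- Call a continuous function $f:\mathbb R\times\mathbb R\to\mathbb R$ (or the equation $x'=f(t,x)$) of Opial type if $f$ is almost periodic in $t$ uniformly with respect to $x$ on every compact subset of $\mathbb R$, every solution of $x'=f(t,x)$ extends to $\mathbb R$ and is bounded on $\mathbb R$, and no solution on $\mathbb R$ is almost periodic. A function $\varphi$ is remotely almost periodic if for every $\varepsilon>0$ there is $l>0$ such that every segment $[a,a+l]$ contains a $\tau$ for which there is $L>0$ with $|\varphi(t+\tau)-\varphi(t)|<\varepsilon$ for all $t\ge L$; for $f(t,x)$, "remotely almost periodic in $t$ uniformly with respect to $x$ on every compact set" means the same with the inequality $|f(t+\tau,x)-f(t,x)|<\varepsilon$ required for all $t\ge L$ and all $x$ in the given compact set. (1) If $x'=f(t,x)$ is of Opial type, then it has no remotely almost periodic solution, neither on $\mathbb R$ nor on $[0,+\infty)$. (2) Equations of Opial type exist, and monotonicity cannot be dropped from the theorem that derives remote almost periodicity of bounded solutions from it. Let $C(\mathbb R\times\mathbb R,\mathbb R)$ have the compact-open topology, and let $f^h(t,x):=f(t+h,x)$. There is an $f$ of Opial type, neither nondecreasing in $x$ for all $t$ nor nonincreasing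 in $x$ for all $t$, such that: $\{f^h: h\ge 0\}$ is precompact; $f$ is remotely almost periodic in $t$ uniformly with respect to $x$ on every compact set; the $\omega$-limit set of $f$ under the shifts is a minimal set (nonempty, closed, invariant under all shifts, with no proper nonempty closed shift-invariant subset); $f$ is regular, i.e. for every $g$ in the closure of $\{f^h: h\in\mathbb R\}$ and every $u\in\mathbb R$ the equation $x'=g(t,x)$ has exactly one solution on $[0,+\infty)$ with $x(0)=u$; and $x'=f(t,x)$ has a solution on $[0,+\infty)$ that is bounded but not remotely almost periodic. -/

import Mathlib

open Set Filter Topology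

namespace ScalarODE

/-- A function `φ : ℝ → ℝ` is almost periodic (Bohr): it is continuous and for every `ε > 0` there
is `l > 0` such that every segment `[a, a + l]` contains an `ε`-almost period. -/
def AlmostPeriodic (φ : ℝ → ℝ) : Prop :=
  Continuous φ ∧ ∀ ε > 0, ∃ l > 0, ∀ a : ℝ, ∃ τ ∈ Icc a (a + l), ∀ t : ℝ, |φ (t + τ) - φ t| < ε

/-- Remote almost periodicity: the inequality is only required for all sufficiently large `t`.
The condition depends only on the values of `φ` on a half-line `[L, ∞)`, so it also makes sense for
functions that are only meaningful on `[0, ∞)`; continuity comes from the differential equation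
wherever the notion is used. -/
def RemotelyAlmostPeriodic (φ : ℝ → ℝ) : Prop :=
  ∀ ε > 0, ∃ l > 0, ∀ a : ℝ, ∃ τ ∈ Icc a (a + l), ∃ L > 0, ∀ t ≥ L, |φ (t + τ) - φ t| < ε

/-- `f(t, x)` is almost periodic in `t` uniformly with respect to `x` on every compact set. -/
def AlmostPeriodicInTime (f : C(ℝ × ℝ, ℝ)) : Prop :=
  ∀ Q : Set ℝ, IsCompact Q → ∀ ε > 0, ∃ l > 0, ∀ a : ℝ, ∃ τ ∈ Icc a (a + l),
    ∀ t : ℝ, ∀ x ∈ Q, |f (t + τ, x) - f (t, x)| < ε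

/-- `f(t, x)` is remotely almost periodic in `t` uniformly with respect to `x` on every
compact set. -/
def RemotelyAlmostPeriodicInTime (f : C(ℝ × ℝ, ℝ)) : Prop :=
  ∀ Q : Set ℝ, IsCompact Q → ∀ ε > 0, ∃ l > 0, ∀ a : ℝ, ∃ τ ∈ Icc a (a + l), ∃ L > 0,
    ∀ t ≥ L, ∀ x ∈ Q, |f (t + τ, x) - f (t, x)| < ε

/-- The translate `f^h(t, x) = f(t + h, x)`. The space `C(ℝ × ℝ, ℝ)` carries the compact-open
topology, and `shift` is the shift dynamical system on it. -/
def shift (h : ℝ) (f : C(ℝ × ℝ, ℝ)) : C(ℝ × ℝ, ℝ) :=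
  f.comp ⟨fun p => (p.1 + h, p.2), by fun_prop⟩

/-- The hull `H(f)`: the closure of the set of all translates. -/
def hull (f : C(ℝ × ℝ, ℝ)) : Set C(ℝ × ℝ, ℝ) :=
  closure (range fun h : ℝ => shift h f)

/-- The positive semi-trajectory of `f` is precompact. -/
def PositivelyLagrangeStable (f : C(ℝ × ℝ, ℝ)) : Prop :=
  IsCompact (closure ((fun h : ℝ => shift h f) '' Ici 0))

/-- The `ω`-limit set of `f` under the shift dynamical system. -/
def omegaLimitSet (f : C(ℝ × ℝ, ℝ)) : Set C(ℝ × ℝ, ℝ) :=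
  omegaLimit atTop shift {f}

/-- Invariance under all shifts. -/
def ShiftInvariant (M : Set C(ℝ × ℝ, ℝ)) : Prop :=
  ∀ h : ℝ, ∀ g ∈ M, shift h g ∈ M

/-- A minimal set: nonempty, closed, invariant, with no proper nonempty closed invariant subset. -/
def IsMinimalSet (M : Set C(ℝ × ℝ, ℝ)) : Prop :=
  M.Nonempty ∧ IsClosed M ∧ ShiftInvariant M ∧
    ∀ N ⊆ M, N.Nonempty → IsClosed N → ShiftInvariant N → N = M

/-- `φ` solves `x' = f(t, x)` on the interval `I` (one-sided derivatives at end points). -/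
def IsSolutionOn (f : C(ℝ × ℝ, ℝ)) (I : Set ℝ) (φ : ℝ → ℝ) : Prop :=
  ∀ t ∈ I, HasDerivWithinAt φ (f (t, φ t)) I t

/-- `φ` is bounded on `I`. -/
def BoundedOn (I : Set ℝ) (φ : ℝ → ℝ) : Prop :=
  ∃ C : ℝ, ∀ t ∈ I, |φ t| ≤ C

/-- `f` is regular: for every `g ∈ H(f)` and `u ∈ ℝ` the equation `x' = g(t, x)` has exactly one
solution on `[0, ∞)` with value `u` at `t = 0`. -/
def IsRegular (f : C(ℝ × ℝ, ℝ)) : Prop :=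
  ∀ g ∈ hull f, ∀ u : ℝ,
    (∃ φ, IsSolutionOn g (Ici 0) φ ∧ φ 0 = u) ∧
    ∀ φ ψ, IsSolutionOn g (Ici 0) φ → IsSolutionOn g (Ici 0) ψ → φ 0 = u → ψ 0 = u →
      EqOn φ ψ (Ici 0)

/-- All solutions of `x' = f(t, x)` are bounded on `ℝ`: every solution on a nonempty open interval
extends to a solution on the whole of `ℝ`, and every solution on `ℝ` is bounded. -/
def AllSolutionsBounded (f : C(ℝ × ℝ, ℝ)) : Prop :=
  (∀ I : Set ℝ, IsOpen I → I.OrdConnected → I.Nonempty → ∀ φ, IsSolutionOn f I φ →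
    ∃ ψ, IsSolutionOn f univ ψ ∧ EqOn φ ψ I) ∧
  ∀ φ, IsSolutionOn f univ φ → BoundedOn univ φ

/-- The equations of Opial's type: `f` is almost periodic in `t` uniformly on compact sets of `x`,
all solutions of `x' = f(t, x)` are bounded on `ℝ`, and none is almost periodic. -/
structure IsOpialEquation (f : C(ℝ × ℝ, ℝ)) : Prop where
  almostPeriodic : AlmostPeriodicInTime f
  bounded : AllSolutionsBounded f
  not_almostPeriodic : ∀ φ, IsSolutionOn f univ φ → ¬ AlmostPeriodic φ

/-- `f` is monotone (order preserving) in `x`. -/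
def MonotoneInState (f : C(ℝ × ℝ, ℝ)) : Prop :=
  ∀ t x₁ x₂ : ℝ, x₁ ≤ x₂ → f (t, x₁) ≤ f (t, x₂)

/-- `f` is antitone (order reversing) in `x`. -/
def AntitoneInState (f : C(ℝ × ℝ, ℝ)) : Prop :=
  ∀ t x₁ x₂ : ℝ, x₁ ≤ x₂ → f (t, x₂) ≤ f (t, x₁)

end ScalarODE

/-! For the nonexistence half, translate a bounded remotely almost periodic solution along almost
periods of `f` that tend to infinity with errors tending to zero. A pointwise limit of the
translates solves the same equation, and an inequality valid for large times becomes valid for all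
times. So the limit is an almost periodic solution (`exists_almostPeriodic_solution`), which Opial
type forbids.

The example is linear, x' = -S'(t) x + b(t), with S = Σ (3/2)^k sin²(πt/2^k). The weights grow, so S
≥ 0 is unbounded; but (3/2)^k / 2^k is summable, so S' is a uniform limit of periodic functions. The
homogeneous solution e^{-S} is bounded. With S_k the partial sums of S, a particular solution is X =
Σ (-1)^k sin²(πt/2^k) e^{-S_k}. It is bounded because the terms are dominated by a telescoping
series (`abs_pulse_le_sub`). Its forcing b = X' + S'X converges uniformly, because differentiating
e^{-S_k} cancels S' up to a tail (`abs_pulseDefect_le`). Hence the equation is almost periodic and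
every solution X + c e^{-S} is bounded.

At 2^n - 2^m with m < n and m large, X is close to (-1)^{m+1} and e^{-S} to 0, while the solution
equals c at 0. If it were almost periodic, some of these differences would be almost periods, with m
of either prescribed parity; so c would be both -1 and 1 (`AlmostPeriodic.coeff_eq`).

Compactness and minimality follow from almost periodicity in time, regularity from linearity. -/

namespace ScalarODE

/-! ### The compact-open topology and the shifts. -/

theorem uniformity_basis_compact :
    (uniformity C(ℝ × ℝ, ℝ)).HasBasis (fun p : Set (ℝ × ℝ) × ℝ => IsCompact p.1 ∧ 0 < p.2)
      fun p => {fg | ∀ x ∈ p.1, |fg.1 x - fg.2 x| < p.2} :=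
  Metric.uniformity_basis_dist.compactConvergenceUniformity

theorem mem_closure_iff_compact {S : Set C(ℝ × ℝ, ℝ)} {g : C(ℝ × ℝ, ℝ)} :
    g ∈ closure S ↔ ∀ K : Set (ℝ × ℝ), IsCompact K → ∀ ε > 0, ∃ f ∈ S, ∀ p ∈ K,
      |g p - f p| < ε := by
  rw [mem_closure_iff_nhds_basis (nhds_basis_uniformity' uniformity_basis_compact)]
  constructor
  · intro h K hK ε hε
    exact h (K, ε) ⟨hK, hε⟩
  · rintro h ⟨K, ε⟩ ⟨hK, hε⟩
    exact h K hK ε hε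

@[simp] theorem shift_apply (h : ℝ) (f : C(ℝ × ℝ, ℝ)) (p : ℝ × ℝ) :
    shift h f p = f (p.1 + h, p.2) := rfl

theorem continuous_shift (h : ℝ) : Continuous (shift h) :=
  ContinuousMap.continuous_precomp _

theorem continuous_shift_left (f : C(ℝ × ℝ, ℝ)) : Continuous fun h => shift h f := by
  apply ContinuousMap.continuous_of_continuous_uncurry
  show Continuous fun q : ℝ × (ℝ × ℝ) => f (q.2.1 + q.1, q.2.2)
  fun_prop

theorem shift_shift (h k : ℝ) (f : C(ℝ × ℝ, ℝ)) : shift h (shift k f) = shift (h + k) f := by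
  ext p
  simp [add_assoc]

theorem shift_mem_hull (h : ℝ) {f g : C(ℝ × ℝ, ℝ)} (hg : g ∈ hull f) : shift h g ∈ hull f := by
  refine map_mem_closure (continuous_shift h) hg ?_
  rintro _ ⟨k, rfl⟩
  exact ⟨h + k, (shift_shift h k f).symm⟩

/-! ### Hulls of almost periodic right-hand sides. -/

/-- Up to `ε`, every translate is a translate by a number of a fixed bounded segment. -/
theorem AlmostPeriodicInTime.exists_near {f : C(ℝ × ℝ, ℝ)} (hf : AlmostPeriodicInTime f)
    {Q : Set ℝ} (hQ : IsCompact Q) {ε : ℝ} (hε : 0 < ε) :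
    ∃ l > 0, ∀ h : ℝ, ∃ r ∈ Icc 0 l, ∀ t : ℝ, ∀ x ∈ Q, |f (t + h, x) - f (t + r, x)| < ε := by
  obtain ⟨l, hl, H⟩ := hf Q hQ ε hε
  refine ⟨l, hl, fun h => ?_⟩
  obtain ⟨τ, ⟨h1, h2⟩, hτ⟩ := H (h - l)
  refine ⟨h - τ, ⟨by linarith, by linarith⟩, fun t x hx => ?_⟩
  have := hτ (t + (h - τ)) x hx
  rwa [show t + (h - τ) + τ = t + h by ring] at this

/-- The orbit lies within any tolerance of a compact arc `h ∈ Icc 0 l`, so it is totally bounded in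
a complete space. -/
theorem AlmostPeriodicInTime.isCompact_hull {f : C(ℝ × ℝ, ℝ)} (hf : AlmostPeriodicInTime f) :
    IsCompact (hull f) := by
  refine TotallyBounded.isCompact_of_isClosed ?_ isClosed_closure
  refine TotallyBounded.closure ?_
  rw [uniformity_basis_compact.totallyBounded_iff]
  rintro ⟨K, ε⟩ ⟨hK, hε⟩
  dsimp only at hK hε
  obtain ⟨l, hl, H⟩ := hf.exists_near (hK.image continuous_snd) (half_pos hε)
  have hc : TotallyBounded ((fun h => shift h f) '' Icc 0 l) :=
    (isCompact_Icc.image (continuous_shift_left f)).totallyBounded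
  obtain ⟨t, ht, hcov⟩ :=
    (uniformity_basis_compact.totallyBounded_iff.1 hc) (K, ε / 2) ⟨hK, half_pos hε⟩
  refine ⟨t, ht, ?_⟩
  rintro _ ⟨h, rfl⟩
  obtain ⟨r, hr, hr'⟩ := H h
  have := hcov ⟨r, hr, rfl⟩
  simp only [mem_iUnion] at this ⊢
  obtain ⟨y, hy, hy'⟩ := this
  refine ⟨y, hy, fun p hp => ?_⟩
  have h1 := hy' p hp
  have h2 := hr' p.1 p.2 ⟨p, hp, rfl⟩
  simp only [shift_apply] at h1 h2 ⊢
  rw [abs_lt] at *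
  constructor <;> linarith [h1.1, h1.2, h2.1, h2.2]

theorem AlmostPeriodicInTime.positivelyLagrangeStable {f : C(ℝ × ℝ, ℝ)}
    (hf : AlmostPeriodicInTime f) : PositivelyLagrangeStable f :=
  hf.isCompact_hull.of_isClosed_subset isClosed_closure (closure_mono (image_subset_range _ _))

theorem AlmostPeriodicInTime.remotely {f : C(ℝ × ℝ, ℝ)} (hf : AlmostPeriodicInTime f) :
    RemotelyAlmostPeriodicInTime f := by
  intro Q hQ ε hε
  obtain ⟨l, hl, H⟩ := hf Q hQ ε hε
  refine ⟨l, hl, fun a => ?_⟩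
  obtain ⟨τ, hτ, h⟩ := H a
  exact ⟨τ, hτ, 1, one_pos, fun t _ => h t⟩

/-- Almost periods exist beyond every bound, so each translate is approximated by arbitrarily late
ones. -/
theorem AlmostPeriodicInTime.omegaLimitSet_eq {f : C(ℝ × ℝ, ℝ)} (hf : AlmostPeriodicInTime f) :
    omegaLimitSet f = hull f := by
  apply Subset.antisymm
  · refine (omegaLimit_subset_closure_image2 _ _ _ univ_mem).trans (closure_mono ?_)
    rintro _ ⟨h, -, g, hg, rfl⟩
    rw [mem_singleton_iff.1 hg]
    exact ⟨h, rfl⟩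
  · refine closure_minimal ?_ (isClosed_omegaLimit _ _ _)
    rintro _ ⟨h, rfl⟩
    rw [omegaLimitSet, omegaLimit_def]
    refine mem_iInter₂.2 fun u hu => ?_
    obtain ⟨b, hb⟩ := mem_atTop_sets.1 hu
    rw [mem_closure_iff_compact]
    intro K hK ε hε
    obtain ⟨l, hl, H⟩ := hf _ (hK.image continuous_snd) ε hε
    obtain ⟨τ, ⟨h1, h2⟩, hτ⟩ := H (b - h)
    refine ⟨shift (h + τ) f, ⟨h + τ, hb _ (by linarith), f, rfl, rfl⟩, fun p hp => ?_⟩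
    have := hτ (p.1 + h) p.2 ⟨p, hp, rfl⟩
    rw [abs_sub_comm]
    simpa [add_assoc] using this

theorem AlmostPeriodicInTime.mem_of_mem_hull {f g : C(ℝ × ℝ, ℝ)} (hf : AlmostPeriodicInTime f)
    (hg : g ∈ hull f) : f ∈ hull g := by
  refine mem_closure_iff_compact.2 fun K hK ε hε => ?_
  obtain ⟨l, hl, H⟩ := hf.exists_near (hK.image continuous_snd) (half_pos hε)
  -- The shift `r ∈ Icc 0 l` that undoes `h` is known only after `h` is chosen, so the approximation
  -- is requested on all the back-shifts of `K` at once.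
  have hK' : IsCompact ((fun q : (ℝ × ℝ) × ℝ => (q.1.1 - q.2, q.1.2)) '' K ×ˢ Icc 0 l) :=
    (hK.prod isCompact_Icc).image (by fun_prop)
  obtain ⟨_, ⟨h, rfl⟩, hh⟩ := mem_closure_iff_compact.1 hg _ hK' _ (half_pos hε)
  obtain ⟨r, hr, hr'⟩ := H h
  refine ⟨_, ⟨-r, rfl⟩, fun p hp => ?_⟩
  have h1 := hh (p.1 - r, p.2) ⟨(p, r), ⟨hp, hr⟩, rfl⟩
  have h2 := hr' (p.1 - r) p.2 ⟨p, hp, rfl⟩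
  simp only [shift_apply, sub_add_cancel, ← sub_eq_add_neg, Prod.mk.eta] at h1 h2 ⊢
  rw [abs_lt] at *
  constructor <;> linarith [h1.1, h1.2, h2.1, h2.2]

theorem AlmostPeriodicInTime.isMinimalSet_hull {f : C(ℝ × ℝ, ℝ)} (hf : AlmostPeriodicInTime f) :
    IsMinimalSet (hull f) := by
  refine ⟨⟨_, subset_closure ⟨0, rfl⟩⟩, isClosed_closure, fun h g hg => shift_mem_hull h hg, ?_⟩
  rintro N hN ⟨g, hg⟩ hcl hinv
  have hfN : f ∈ N :=
    closure_minimal (range_subset_iff.2 fun h => hinv h g hg) hcl (hf.mem_of_mem_hull (hN hg))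
  exact hN.antisymm (closure_minimal (range_subset_iff.2 fun h => hinv h f hfN) hcl)

/-- An almost periodic right-hand side is bounded on compact sets of states. -/
theorem AlmostPeriodicInTime.exists_bound {f : C(ℝ × ℝ, ℝ)} (hf : AlmostPeriodicInTime f)
    {Q : Set ℝ} (hQ : IsCompact Q) : ∃ M, ∀ t : ℝ, ∀ x ∈ Q, |f (t, x)| ≤ M := by
  obtain ⟨l, hl, H⟩ := hf.exists_near hQ one_pos
  obtain ⟨C, hC⟩ := (isCompact_Icc.prod hQ : IsCompact (Icc (0 : ℝ) l ×ˢ Q)).exists_bound_of_continuousOn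
    f.continuous.continuousOn
  refine ⟨C + 1, fun t x hx => ?_⟩
  obtain ⟨r, hr, hr'⟩ := H t
  have h1 := hr' 0 x hx
  have h2 := hC (r, x) ⟨hr, hx⟩
  simp only [zero_add, Real.norm_eq_abs] at h1 h2
  have := abs_sub_abs_le_abs_sub (f (t, x)) (f (r, x))
  linarith

/-! ### Limits of translated solutions and remote almost periodicity. -/

theorem IsSolutionOn.hasDerivAt {f : C(ℝ × ℝ, ℝ)} {φ : ℝ → ℝ} (h : IsSolutionOn f univ φ)
    (t : ℝ) : HasDerivAt φ (f (t, φ t)) t :=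
  hasDerivWithinAt_univ.1 (h t (mem_univ t))

theorem isSolutionOn_univ_of_hasDerivAt {f : C(ℝ × ℝ, ℝ)} {φ : ℝ → ℝ}
    (h : ∀ t, HasDerivAt φ (f (t, φ t)) t) : IsSolutionOn f univ φ :=
  fun t _ => (h t).hasDerivWithinAt

/-- A sequence of almost periods tending to infinity, with error tending to zero. -/
theorem AlmostPeriodicInTime.exists_seq {f : C(ℝ × ℝ, ℝ)} (hf : AlmostPeriodicInTime f)
    {Q : Set ℝ} (hQ : IsCompact Q) :
    ∃ h : ℕ → ℝ, Tendsto h atTop atTop ∧ ∀ ε > 0, ∀ᶠ n in atTop, ∀ t : ℝ, ∀ x ∈ Q,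
      |f (t + h n, x) - f (t, x)| < ε := by
  have H : ∀ n : ℕ, ∃ h : ℝ, (n : ℝ) ≤ h ∧ ∀ t : ℝ, ∀ x ∈ Q,
      |f (t + h, x) - f (t, x)| < 1 / ((n : ℝ) + 1) := by
    intro n
    obtain ⟨l, -, H⟩ := hf Q hQ _ (Nat.one_div_pos_of_nat (n := n))
    obtain ⟨τ, hτ, h⟩ := H n
    exact ⟨τ, hτ.1, h⟩
  choose h h1 h2 using H
  refine ⟨h, tendsto_atTop_mono h1 tendsto_natCast_atTop_atTop, fun ε hε => ?_⟩
  filter_upwards [(tendsto_one_div_add_atTop_nhds_zero_nat (𝕜 := ℝ)).eventually (gt_mem_nhds hε)]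
    with n hn t x hx
  exact (h2 n t x hx).trans hn

/-- A pointwise limit of translates of a bounded solution, along translates of the equation
converging to the equation itself, is again a solution. -/
theorem isSolutionOn_limit {f : C(ℝ × ℝ, ℝ)} {φ ψ : ℝ → ℝ} {C M : ℝ} {U : Filter ℕ} [U.NeBot]
    {h : ℕ → ℝ} (hφ : IsSolutionOn f univ φ) (hC : ∀ t, φ t ∈ Icc (-C) C)
    (hM : ∀ t : ℝ, ∀ x ∈ Icc (-C) C, |f (t, x)| ≤ M)
    (hh : ∀ ε > 0, ∀ᶠ n in U, ∀ t : ℝ, ∀ x ∈ Icc (-C) C, |f (t + h n, x) - f (t, x)| < ε)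
    (hψ : ∀ t, Tendsto (fun n => φ (t + h n)) U (𝓝 (ψ t))) : IsSolutionOn f univ ψ := by
  refine isSolutionOn_univ_of_hasDerivAt fun t => ?_
  have hM0 : 0 ≤ M := (abs_nonneg _).trans (hM 0 _ (hC 0))
  have hlip : ∀ r s, |φ r - φ s| ≤ M * |r - s| := fun r s =>
    convex_univ.norm_image_sub_le_of_norm_hasDerivWithin_le (fun x hx => hφ x hx)
      (fun x _ => hM x _ (hC x)) (mem_univ s) (mem_univ r)
  rw [hasDerivAt_iff_isLittleO, Asymptotics.isLittleO_iff]
  intro ε hε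
  obtain ⟨δ, hδ, hcont⟩ := Metric.continuousAt_iff.1 (f.continuous.continuousAt (x := (t, ψ t)))
    (ε / 2) (half_pos hε)
  -- On this radius `φ` moves by less than `δ / 2`, by its Lipschitz constant `M`; the other half of
  -- `δ` is the distance from `φ (t + h n)` to `ψ t`.
  have hη : 0 < min δ (δ / (2 * (M + 1))) := by positivity
  filter_upwards [Metric.ball_mem_nhds t hη] with s hs
  -- The linearization error is bounded by the mean value inequality uniformly in `n`, so it
  -- survives the pointwise limit; no locally uniform convergence is needed.
  have key : ∀ᶠ n in U, |φ (s + h n) - φ (t + h n) - (s - t) * f (t, ψ t)| ≤ ε * |s - t| := by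
    filter_upwards [hh _ (half_pos hε), (hψ t).eventually (Metric.ball_mem_nhds _ (half_pos hδ))]
      with n h1 h2
    have hd : ∀ r ∈ Metric.ball t (min δ (δ / (2 * (M + 1)))),
        HasDerivWithinAt (fun r => φ (r + h n) - r * f (t, ψ t))
          (f (r + h n, φ (r + h n)) - f (t, ψ t)) (Metric.ball t (min δ (δ / (2 * (M + 1))))) r := by
      intro r _
      have := ((hφ.hasDerivAt (r + h n)).comp_add_const r (h n)).sub
        ((hasDerivAt_id r).mul_const (f (t, ψ t)))
      rw [one_mul] at this
      exact this.hasDerivWithinAt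
    have := (convex_ball t _).norm_image_sub_le_of_norm_hasDerivWithin_le hd
      (C := ε) ?_ (Metric.mem_ball_self hη) hs
    · simp only [Real.norm_eq_abs] at this
      convert this using 2
      ring
    · intro r hr
      rw [Metric.mem_ball, lt_min_iff, Real.dist_eq, lt_div_iff₀ (by positivity)] at hr
      rw [Real.dist_eq] at h2
      have h3 := h1 r _ (hC (r + h n))
      have h4 := hlip (r + h n) (t + h n)
      rw [add_sub_add_right_eq_sub] at h4
      have h5 : |φ (r + h n) - ψ t| < δ := by
        have := abs_sub_le (φ (r + h n)) (φ (t + h n)) (ψ t)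
        nlinarith [abs_nonneg (r - t)]
      have h6 := @hcont (r, φ (r + h n)) (by
        rw [Prod.dist_eq, max_lt_iff, Real.dist_eq, Real.dist_eq]
        exact ⟨hr.1, h5⟩)
      rw [Real.dist_eq] at h6
      rw [Real.norm_eq_abs]
      linarith [abs_sub_le (f (r + h n, φ (r + h n))) (f (r, φ (r + h n))) (f (t, ψ t))]
  have hlim : Tendsto (fun n => |φ (s + h n) - φ (t + h n) - (s - t) * f (t, ψ t)|) U
      (𝓝 |ψ s - ψ t - (s - t) * f (t, ψ t)|) := (((hψ s).sub (hψ t)).sub_const _).abs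
  simpa using le_of_tendsto hlim key

theorem exists_almostPeriodic_solution {f : C(ℝ × ℝ, ℝ)} (hf : AlmostPeriodicInTime f)
    {φ : ℝ → ℝ} (hφ : IsSolutionOn f univ φ) (hb : BoundedOn univ φ)
    (hr : RemotelyAlmostPeriodic φ) : ∃ ψ, IsSolutionOn f univ ψ ∧ AlmostPeriodic ψ := by
  obtain ⟨C, hC⟩ := hb
  replace hC : ∀ t, φ t ∈ Icc (-C) C := fun t => abs_le.1 (hC t (mem_univ t))
  obtain ⟨M, hM⟩ := hf.exists_bound (isCompact_Icc (a := -C) (b := C))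
  obtain ⟨h, hinf, hh⟩ := hf.exists_seq (isCompact_Icc (a := -C) (b := C))
  -- A free ultrafilter gives limits at all times simultaneously, without a diagonal subsequence.
  have hU : (hyperfilter ℕ : Filter ℕ) ≤ atTop := Nat.hyperfilter_le_atTop
  have hlim : ∀ t, ∃ y, Tendsto (fun n => φ (t + h n)) (hyperfilter ℕ) (𝓝 y) := by
    intro t
    obtain ⟨y, -, hy⟩ := (isCompact_Icc (a := -C) (b := C)).ultrafilter_le_nhds
      ((hyperfilter ℕ).map fun n => φ (t + h n))
      (tendsto_principal.2 (Eventually.of_forall fun n => hC _))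
    exact ⟨y, hy⟩
  choose ψ hψ using hlim
  have hsol : IsSolutionOn f univ ψ :=
    isSolutionOn_limit hφ hC hM (fun ε hε => (hh ε hε).filter_mono hU) hψ
  refine ⟨ψ, hsol, continuous_iff_continuousAt.2 fun t => (hsol.hasDerivAt t).continuousAt, ?_⟩
  intro ε hε
  obtain ⟨l, hl, H⟩ := hr _ (half_pos hε)
  refine ⟨l, hl, fun a => ?_⟩
  obtain ⟨τ, hτ, L, -, hL⟩ := H a
  refine ⟨τ, hτ, fun t => ?_⟩
  refine (le_of_tendsto ((hψ (t + τ)).sub (hψ t)).abs ?_).trans_lt (half_lt_self hε)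
  filter_upwards [(hinf.mono_left hU).eventually_ge_atTop (L - t)] with n hn
  have := hL (t + h n) (by linarith)
  rw [add_right_comm] at this
  exact this.le

theorem RemotelyAlmostPeriodic.congr {φ ψ : ℝ → ℝ} (hφ : RemotelyAlmostPeriodic φ)
    (h : EqOn φ ψ (Ioi 0)) : RemotelyAlmostPeriodic ψ := by
  intro ε hε
  obtain ⟨l, hl, H⟩ := hφ ε hε
  refine ⟨l, hl, fun a => ?_⟩
  obtain ⟨τ, hτ, L, hL, h'⟩ := H a
  -- `τ` may be negative; the enlarged threshold keeps both `t` and `t + τ` positive.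
  refine ⟨τ, hτ, L + |τ|, by positivity, fun t ht => ?_⟩
  have h1 := neg_abs_le τ
  have h2 := abs_nonneg τ
  rw [← h (mem_Ioi.2 (by linarith : 0 < t + τ)), ← h (mem_Ioi.2 (by linarith : 0 < t))]
  exact h' t (by linarith)

theorem IsOpialEquation.not_remotelyAlmostPeriodic {f : C(ℝ × ℝ, ℝ)} (hf : IsOpialEquation f)
    {φ : ℝ → ℝ} (hφ : IsSolutionOn f univ φ) : ¬ RemotelyAlmostPeriodic φ := by
  intro hr
  obtain ⟨ψ, h1, h2⟩ := exists_almostPeriodic_solution hf.almostPeriodic hφ (hf.bounded.2 φ hφ) hr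
  exact hf.not_almostPeriodic ψ h1 h2

theorem IsOpialEquation.not_remotelyAlmostPeriodic_Ici {f : C(ℝ × ℝ, ℝ)} (hf : IsOpialEquation f)
    {φ : ℝ → ℝ} (hφ : IsSolutionOn f (Ici 0) φ) : ¬ RemotelyAlmostPeriodic φ := by
  intro hr
  obtain ⟨ψ, h1, h2⟩ := hf.bounded.1 (Ioi 0) isOpen_Ioi ordConnected_Ioi nonempty_Ioi φ
    fun t ht => (hφ t (Ioi_subset_Ici_self ht)).mono Ioi_subset_Ici_self
  exact hf.not_remotelyAlmostPeriodic h1 (hr.congr h2)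

/-! ### Linear equations. -/

/-- The right-hand side of the linear equation `x' = a(t) x + b(t)`. -/
def linearField (a b : C(ℝ, ℝ)) : C(ℝ × ℝ, ℝ) :=
  ⟨fun p => a p.1 * p.2 + b p.1, by fun_prop⟩

@[simp] theorem linearField_apply (a b : C(ℝ, ℝ)) (p : ℝ × ℝ) :
    linearField a b p = a p.1 * p.2 + b p.1 := rfl

/-- On an interval, every solution of a linear equation is a particular solution plus a multiple of
a nonvanishing solution of the homogeneous equation. -/
theorem IsSolutionOn.eq_add_mul {a b : C(ℝ, ℝ)} {E X φ : ℝ → ℝ} {I : Set ℝ}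
    (hI : I.OrdConnected) (hφ : IsSolutionOn (linearField a b) I φ)
    (hE : ∀ t, HasDerivAt E (a t * E t) t) (hE0 : ∀ t, E t ≠ 0)
    (hX : ∀ t, HasDerivAt X (a t * X t + b t) t) : ∃ c, ∀ t ∈ I, φ t = X t + c * E t := by
  rcases I.eq_empty_or_nonempty with rfl | ⟨s, hs⟩
  · exact ⟨0, fun t ht => ht.elim⟩
  refine ⟨(φ s - X s) / E s, fun t ht => ?_⟩
  have hd : ∀ r ∈ I, HasDerivWithinAt (fun r => (φ r - X r) / E r) 0 I r := by
    intro r hr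
    have := ((hφ r hr).sub (hX r).hasDerivWithinAt).div (hE r).hasDerivWithinAt (hE0 r)
    refine this.congr_deriv ?_
    rw [div_eq_zero_iff]
    left
    simp only [linearField_apply, Pi.sub_apply]
    ring
  have := hI.convex.norm_image_sub_le_of_norm_hasDerivWithin_le hd (C := 0) (by simp) hs ht
  rw [zero_mul, norm_le_zero_iff, sub_eq_zero] at this
  rw [← this, div_mul_cancel₀ _ (hE0 t)]
  ring

theorem exists_homogeneous_solution (a : C(ℝ, ℝ)) :
    ∃ E : ℝ → ℝ, (∀ t, 0 < E t) ∧ ∀ t, HasDerivAt E (a t * E t) t := by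
  refine ⟨fun t => Real.exp (∫ s in (0 : ℝ)..t, a s), fun t => Real.exp_pos _, fun t => ?_⟩
  have := (intervalIntegral.integral_hasDerivAt_right (a.continuous.intervalIntegrable 0 t)
    a.continuous.aestronglyMeasurable.stronglyMeasurableAtFilter a.continuous.continuousAt).exp
  rwa [mul_comm] at this

theorem exists_particular_solution (a b : C(ℝ, ℝ)) :
    ∃ X : ℝ → ℝ, ∀ t, HasDerivAt X (a t * X t + b t) t := by
  obtain ⟨E, hE0, hE⟩ := exists_homogeneous_solution a
  have hEc : Continuous E := continuous_iff_continuousAt.2 fun t => (hE t).continuousAt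
  have hc : Continuous fun s => b s / E s := b.continuous.div hEc fun t => (hE0 t).ne'
  refine ⟨fun t => E t * ∫ s in (0 : ℝ)..t, b s / E s, fun t => ?_⟩
  refine ((hE t).mul (intervalIntegral.integral_hasDerivAt_right (hc.intervalIntegrable 0 t)
    hc.aestronglyMeasurable.stronglyMeasurableAtFilter hc.continuousAt)).congr_deriv ?_
  have := (hE0 t).ne'
  field_simp

/-- Being affine in the state is a closed condition, and the coefficients can be read off at the
states 0 and 1. -/
theorem exists_linearField_of_mem_hull {a b : C(ℝ, ℝ)} {g : C(ℝ × ℝ, ℝ)}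
    (hg : g ∈ hull (linearField a b)) : ∃ a' b', g = linearField a' b' := by
  refine ⟨⟨fun t => g (t, 1) - g (t, 0), by fun_prop⟩, ⟨fun t => g (t, 0), by fun_prop⟩, ?_⟩
  ext ⟨t, x⟩
  have hcl : IsClosed {g : C(ℝ × ℝ, ℝ) | g (t, x) = (g (t, 1) - g (t, 0)) * x + g (t, 0)} :=
    isClosed_eq (continuous_eval_const _) (by fun_prop)
  refine closure_minimal ?_ hcl hg
  rintro _ ⟨h, rfl⟩
  simp

theorem isRegular_linearField (a b : C(ℝ, ℝ)) : IsRegular (linearField a b) := by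
  intro g hg u
  obtain ⟨a, b, rfl⟩ := exists_linearField_of_mem_hull hg
  obtain ⟨E, hE0, hE⟩ := exists_homogeneous_solution a
  obtain ⟨X, hX⟩ := exists_particular_solution a b
  constructor
  · refine ⟨fun t => X t + (u - X 0) / E 0 * E t, fun t _ => ?_, ?_⟩
    · refine (((hX t).add ((hE t).const_mul _)).congr_deriv ?_).hasDerivWithinAt
      simp only [linearField_apply]
      ring
    · have := (hE0 0).ne'
      field_simp
      ring
  · intro φ ψ hφ hψ h1 h2 t ht
    obtain ⟨c, hc⟩ := hφ.eq_add_mul ordConnected_Ici hE (fun t => (hE0 t).ne') hX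
    obtain ⟨d, hd⟩ := hψ.eq_add_mul ordConnected_Ici hE (fun t => (hE0 t).ne') hX
    have hcd : c = d := by
      have h3 := hc 0 self_mem_Ici
      have h4 := hd 0 self_mem_Ici
      exact mul_right_cancel₀ (hE0 0).ne' (by linarith)
    rw [hc t ht, hd t ht, hcd]

theorem allSolutionsBounded_linearField {a b : C(ℝ, ℝ)} {E X : ℝ → ℝ}
    (hE : ∀ t, HasDerivAt E (a t * E t) t) (hE0 : ∀ t, E t ≠ 0)
    (hX : ∀ t, HasDerivAt X (a t * X t + b t) t) (hEb : BoundedOn univ E)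
    (hXb : BoundedOn univ X) : AllSolutionsBounded (linearField a b) := by
  constructor
  · intro I _ hI _ φ hφ
    obtain ⟨c, hc⟩ := hφ.eq_add_mul hI hE hE0 hX
    refine ⟨fun t => X t + c * E t, isSolutionOn_univ_of_hasDerivAt fun t => ?_, hc⟩
    refine ((hX t).add ((hE t).const_mul c)).congr_deriv ?_
    simp only [linearField_apply]
    ring
  · intro φ hφ
    obtain ⟨c, hc⟩ := hφ.eq_add_mul ordConnected_univ hE hE0 hX
    obtain ⟨C, hC⟩ := hEb
    obtain ⟨D, hD⟩ := hXb
    refine ⟨D + |c| * C, fun t ht => ?_⟩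
    rw [hc t ht]
    refine (abs_add_le _ _).trans (add_le_add (hD t ht) ?_)
    rw [abs_mul]
    exact mul_le_mul_of_nonneg_left (hC t ht) (abs_nonneg c)

/-! ### Limit-periodic and almost periodic functions. -/

/-- `g` is, up to every `ε`, periodic with period a power of two. -/
def DyadicLimitPeriodic (g : ℝ → ℝ) : Prop :=
  ∀ ε > 0, ∀ᶠ n : ℕ in atTop, ∀ (j : ℤ) (t : ℝ), |g (t + j * 2 ^ n) - g t| < ε

theorem almostPeriodicInTime_linearField {a b : C(ℝ, ℝ)} (ha : DyadicLimitPeriodic a)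
    (hb : DyadicLimitPeriodic b) : AlmostPeriodicInTime (linearField a b) := by
  intro Q hQ ε hε
  obtain ⟨C, hC⟩ := hQ.isBounded.exists_norm_le
  have hC' : 0 < |C| + 1 := by positivity
  obtain ⟨n, hna, hnb⟩ := ((ha (ε / 2 / (|C| + 1)) (by positivity)).and
    (hb (ε / 2) (half_pos hε))).exists
  have h2 : (0 : ℝ) < 2 ^ n := by positivity
  refine ⟨2 ^ n, h2, fun r => ⟨⌈r / 2 ^ n⌉ * 2 ^ n, ⟨?_, ?_⟩, fun t x hx => ?_⟩⟩
  · exact (div_le_iff₀ h2).1 (Int.le_ceil _)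
  · have := (Int.ceil_lt_add_one (r / 2 ^ n)).le
    calc (⌈r / 2 ^ n⌉ : ℝ) * 2 ^ n ≤ (r / 2 ^ n + 1) * 2 ^ n := by gcongr
      _ = r + 2 ^ n := by field_simp
  · have h3 := hna ⌈r / 2 ^ n⌉ t
    have h4 := hnb ⌈r / 2 ^ n⌉ t
    have h5 : |x| ≤ |C| + 1 := (hC x hx).trans ((le_abs_self C).trans (by linarith))
    rw [lt_div_iff₀ hC'] at h3
    simp only [linearField_apply]
    set τ : ℝ := ⌈r / 2 ^ n⌉ * 2 ^ n
    calc |a (t + τ) * x + b (t + τ) - (a t * x + b t)|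
        = |(a (t + τ) - a t) * x + (b (t + τ) - b t)| := by ring_nf
      _ ≤ |a (t + τ) - a t| * |x| + |b (t + τ) - b t| := by
        rw [← abs_mul]; exact abs_add_le _ _
      _ ≤ |a (t + τ) - a t| * (|C| + 1) + |b (t + τ) - b t| := by gcongr
      _ < ε := by linarith

theorem DyadicLimitPeriodic.add {g h : ℝ → ℝ} (hg : DyadicLimitPeriodic g)
    (hh : DyadicLimitPeriodic h) : DyadicLimitPeriodic fun t => g t + h t := by
  intro ε hε
  filter_upwards [hg _ (half_pos hε), hh _ (half_pos hε)] with n h1 h2 j t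
  have h3 := abs_lt.1 (h1 j t)
  have h4 := abs_lt.1 (h2 j t)
  rw [abs_lt]
  constructor <;> linarith [h3.1, h3.2, h4.1, h4.2]

theorem DyadicLimitPeriodic.mul {g h : ℝ → ℝ} {C D : ℝ} (hg : DyadicLimitPeriodic g)
    (hh : DyadicLimitPeriodic h) (hC : ∀ t, |g t| ≤ C) (hD : ∀ t, |h t| ≤ D) :
    DyadicLimitPeriodic fun t => g t * h t := by
  intro ε hε
  have hC0 : 0 ≤ C := (abs_nonneg _).trans (hC 0)
  have hD0 : 0 ≤ D := (abs_nonneg _).trans (hD 0)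
  filter_upwards [hg (ε / 2 / (D + 1)) (by positivity), hh (ε / 2 / (C + 1)) (by positivity)]
    with n h1 h2 j t
  have h3 := h1 j t
  have h4 := h2 j t
  rw [lt_div_iff₀ (by positivity)] at h3 h4
  set s := t + j * 2 ^ n
  calc |g s * h s - g t * h t| = |(g s - g t) * h s + g t * (h s - h t)| := by ring_nf
    _ ≤ |g s - g t| * |h s| + |g t| * |h s - h t| := by
      rw [← abs_mul, ← abs_mul]; exact abs_add_le _ _
    _ ≤ |g s - g t| * (D + 1) + (C + 1) * |h s - h t| := by
      gcongr
      · exact (hD s).trans (by linarith)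
      · exact (hC t).trans (by linarith)
    _ < ε := by linarith

theorem dyadicLimitPeriodic_of_periodic {g : ℝ → ℝ} {m : ℕ} (hg : Function.Periodic g (2 ^ m)) :
    DyadicLimitPeriodic g := by
  intro ε hε
  filter_upwards [eventually_ge_atTop m] with n hn j t
  obtain ⟨k, rfl⟩ := Nat.exists_eq_add_of_le hn
  have := hg.int_mul (j * 2 ^ k) t
  push_cast at this
  rw [show t + (j : ℝ) * 2 ^ (m + k) = t + j * 2 ^ k * 2 ^ m by ring, this]
  simpa using hε

theorem DyadicLimitPeriodic.of_tendstoUniformly {G : ℕ → ℝ → ℝ} {g : ℝ → ℝ}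
    (hG : ∀ k, DyadicLimitPeriodic (G k)) (h : TendstoUniformly G g atTop) :
    DyadicLimitPeriodic g := by
  intro ε hε
  obtain ⟨k, hk⟩ := (Metric.tendstoUniformly_iff.1 h (ε / 3) (by positivity)).exists
  filter_upwards [hG k (ε / 3) (by positivity)] with n hn j t
  have h1 := abs_lt.1 (hn j t)
  have h2 := abs_lt.1 (hk t)
  have h3 := abs_lt.1 (hk (t + j * 2 ^ n))
  rw [abs_lt]
  constructor <;> linarith [h1.1, h1.2, h2.1, h2.2, h3.1, h3.2]

theorem DyadicLimitPeriodic.sum {G : ℕ → ℝ → ℝ} (hG : ∀ k, DyadicLimitPeriodic (G k)) (n : ℕ) :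
    DyadicLimitPeriodic fun t => ∑ k ∈ Finset.range n, G k t := by
  induction n with
  | zero =>
    intro ε hε
    refine Eventually.of_forall fun n j t => ?_
    simpa using hε
  | succ n ih =>
    simp only [Finset.sum_range_succ]
    exact ih.add (hG n)

theorem DyadicLimitPeriodic.tsum {G : ℕ → ℝ → ℝ} {u : ℕ → ℝ}
    (hG : ∀ k, DyadicLimitPeriodic (G k)) (hu : Summable u) (h : ∀ k t, |G k t| ≤ u k) :
    DyadicLimitPeriodic fun t => ∑' k, G k t :=
  .of_tendstoUniformly (fun n => .sum hG n) (tendstoUniformly_tsum_nat hu h)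

/-- Among infinitely many translates of a uniformly continuous almost periodic function, two are
uniformly close. -/
theorem AlmostPeriodic.exists_almostPeriod_sub {φ : ℝ → ℝ} (hφ : AlmostPeriodic φ)
    (hu : UniformContinuous φ) (h : ℕ → ℝ) {ε : ℝ} (hε : 0 < ε) (N : ℕ) :
    ∃ m ≥ N, ∃ n > m, ∀ t, |φ (t + (h n - h m)) - φ t| < ε := by
  obtain ⟨l, hl, H⟩ := hφ.2 (ε / 3) (by positivity)
  obtain ⟨δ, hδ, hδ'⟩ := Metric.uniformContinuous_iff.1 hu (ε / 3) (by positivity)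
  choose τ hτ hτ' using fun n => H (h n - l)
  have hr : ∀ n, h n - τ n ∈ Icc 0 l := fun n => ⟨by linarith [(hτ n).2], by linarith [(hτ n).1]⟩
  -- Modulo almost periods the shifts lie in `Icc 0 l`. Two of these remainders within `δ` of each
  -- other cost `ε / 3` by uniform continuity, and the two almost periods cost `ε / 3` each.
  obtain ⟨y, -, k, hk, hlim⟩ := isCompact_Icc.tendsto_subseq hr
  obtain ⟨P, hP⟩ := Metric.cauchySeq_iff.1 hlim.cauchySeq δ hδ
  refine ⟨k (max P N), (le_max_right _ _).trans (hk.id_le _), k (max P N + 1),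
    hk (Nat.lt_succ_self _), fun t => ?_⟩
  have hd := hP (max P N + 1) ((le_max_left _ _).trans (Nat.le_succ _)) (max P N) (le_max_left _ _)
  simp only [Function.comp_apply] at hd
  generalize k (max P N + 1) = n at *
  generalize k (max P N) = m at *
  have h1 := hτ' n (t + (h n - h m) - τ n)
  have h2 := hτ' m (t - τ m)
  have h3 := @hδ' (t + (h n - h m) - τ n) (t - τ m) (by
    rw [Real.dist_eq] at hd ⊢
    convert hd using 2
    ring)
  rw [sub_add_cancel] at h1 h2
  rw [Real.dist_eq] at h3
  rw [abs_lt] at *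
  constructor <;> linarith [h1.1, h1.2, h2.1, h2.2, h3.1, h3.2]

/-! ### The exponent, the pulses and their estimates. -/

/-- A smooth function of period `2 ^ k`, vanishing exactly on the multiples of `2 ^ k`. -/
noncomputable def bump (k : ℕ) (t : ℝ) : ℝ := Real.sin (Real.pi * t / 2 ^ k) ^ 2

/-- The derivative of `bump k`. -/
noncomputable def bumpDeriv (k : ℕ) (t : ℝ) : ℝ :=
  2 * Real.sin (Real.pi * t / 2 ^ k) * Real.cos (Real.pi * t / 2 ^ k) * (Real.pi / 2 ^ k)

/-- The weight of `bump k` in the exponent. -/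
noncomputable def weight (k : ℕ) : ℝ := (3 / 2) ^ k

noncomputable def partialExponent (n : ℕ) (t : ℝ) : ℝ :=
  ∑ k ∈ Finset.range n, weight k * bump k t

noncomputable def partialExponentDeriv (n : ℕ) (t : ℝ) : ℝ :=
  ∑ k ∈ Finset.range n, weight k * bumpDeriv k t

/-- The series does not converge uniformly on the line; only its derivative series does. -/
noncomputable def exponent (t : ℝ) : ℝ := ∑' k, weight k * bump k t

noncomputable def exponentDeriv (t : ℝ) : ℝ := ∑' k, weight k * bumpDeriv k t

/-- The pulses, concentrated near the odd multiples of `2 ^ (k - 1)`, with alternating signs. -/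
noncomputable def pulse (k : ℕ) (t : ℝ) : ℝ :=
  (-1) ^ k * (bump k t * Real.exp (-partialExponent k t))

/-- The defect of `pulse k` as a solution of the homogeneous equation. -/
noncomputable def pulseDefect (k : ℕ) (t : ℝ) : ℝ :=
  (-1) ^ k * Real.exp (-partialExponent k t) *
    (bumpDeriv k t + (exponentDeriv t + -partialExponentDeriv k t) * bump k t)

noncomputable def pulseSum (t : ℝ) : ℝ := ∑' k, pulse k t

noncomputable def forcing (t : ℝ) : ℝ := ∑' k, pulseDefect k t

theorem bump_nonneg (k : ℕ) (t : ℝ) : 0 ≤ bump k t := sq_nonneg _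

theorem bump_le_one (k : ℕ) (t : ℝ) : bump k t ≤ 1 := Real.sin_sq_le_one _

theorem weight_pos (k : ℕ) : 0 < weight k := by unfold weight; positivity

theorem one_le_weight (k : ℕ) : 1 ≤ weight k := one_le_pow₀ (by norm_num)

theorem bump_le (k : ℕ) (t : ℝ) : bump k t ≤ 16 * t ^ 2 * (1 / 4) ^ k := by
  calc bump k t ≤ (Real.pi * t / 2 ^ k) ^ 2 := sq_le_sq.2 Real.abs_sin_le_abs
    _ = Real.pi ^ 2 * (t ^ 2 * (1 / 4) ^ k) := by
      rw [div_pow, mul_pow, ← pow_mul, mul_comm k 2, pow_mul, one_div, inv_pow]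
      norm_num
      ring
    _ ≤ 4 ^ 2 * (t ^ 2 * (1 / 4) ^ k) := by
      gcongr
      exact Real.pi_le_four
    _ = _ := by ring

theorem abs_bumpDeriv_le (k : ℕ) (t : ℝ) : |bumpDeriv k t| ≤ 8 * (1 / 2) ^ k := by
  unfold bumpDeriv
  rw [abs_mul, abs_mul, abs_mul, abs_two, abs_of_pos (by positivity : 0 < Real.pi / 2 ^ k)]
  calc 2 * |Real.sin (Real.pi * t / 2 ^ k)| * |Real.cos (Real.pi * t / 2 ^ k)| * (Real.pi / 2 ^ k)
      ≤ 2 * 1 * 1 * (4 / 2 ^ k) := by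
        gcongr
        · exact Real.abs_sin_le_one _
        · exact Real.abs_cos_le_one _
        · exact Real.pi_le_four
    _ = 8 * (1 / 2) ^ k := by rw [one_div, inv_pow]; ring

theorem hasDerivAt_bump (k : ℕ) (t : ℝ) : HasDerivAt (bump k) (bumpDeriv k t) t := by
  have := (((hasDerivAt_id t).const_mul Real.pi).div_const (2 ^ k)).sin.pow 2
  refine this.congr_deriv ?_
  simp only [bumpDeriv, id]
  ring

theorem periodic_bump (k : ℕ) : Function.Periodic (bump k) (2 ^ k) := by
  intro t
  have h2 : (2 : ℝ) ^ k ≠ 0 := by positivity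
  unfold bump
  rw [mul_add, add_div, mul_div_cancel_right₀ _ h2, Real.sin_add_pi, neg_sq]

theorem periodic_bumpDeriv (k : ℕ) : Function.Periodic (bumpDeriv k) (2 ^ k) := by
  intro t
  have h2 : (2 : ℝ) ^ k ≠ 0 := by positivity
  unfold bumpDeriv
  rw [mul_add, add_div, mul_div_cancel_right₀ _ h2, Real.sin_add_pi, Real.cos_add_pi]
  ring

theorem continuous_bump (k : ℕ) : Continuous (bump k) := by unfold bump; fun_prop

theorem continuous_bumpDeriv (k : ℕ) : Continuous (bumpDeriv k) := by unfold bumpDeriv; fun_prop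

theorem abs_weight_mul_bumpDeriv_le (k : ℕ) (t : ℝ) :
    |weight k * bumpDeriv k t| ≤ 8 * (3 / 4) ^ k := by
  rw [abs_mul, abs_of_pos (weight_pos k)]
  refine (mul_le_mul_of_nonneg_left (abs_bumpDeriv_le k t) (weight_pos k).le).trans_eq ?_
  rw [weight, mul_left_comm, ← mul_pow]
  norm_num

theorem summable_const_mul_geometric (C : ℝ) : Summable fun k : ℕ => C * (3 / 4 : ℝ) ^ k :=
  (summable_geometric_of_lt_one (by norm_num) (by norm_num)).mul_left C

theorem summable_weight_mul_bump (t : ℝ) : Summable fun k => weight k * bump k t := by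
  refine .of_nonneg_of_le (fun k => mul_nonneg (weight_pos k).le (bump_nonneg k t)) (fun k => ?_)
    ((summable_geometric_of_lt_one (r := 3 / 8) (by norm_num) (by norm_num)).mul_left (16 * t ^ 2))
  calc weight k * bump k t ≤ weight k * (16 * t ^ 2 * (1 / 4) ^ k) := by
        gcongr
        · exact (weight_pos k).le
        · exact bump_le k t
    _ = 16 * t ^ 2 * (3 / 8) ^ k := by
        rw [weight, mul_left_comm, ← mul_pow]
        norm_num

theorem hasDerivAt_exponent (t : ℝ) : HasDerivAt exponent (exponentDeriv t) t :=
  hasDerivAt_tsum (summable_const_mul_geometric 8)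
    (fun k t => (hasDerivAt_bump k t).const_mul (weight k))
    (fun k t => abs_weight_mul_bumpDeriv_le k t) (summable_weight_mul_bump 0) t

theorem continuous_exponentDeriv : Continuous exponentDeriv :=
  continuous_tsum (fun k => continuous_const.mul (continuous_bumpDeriv k))
    (summable_const_mul_geometric 8) abs_weight_mul_bumpDeriv_le

theorem summable_weight_mul_bumpDeriv (t : ℝ) : Summable fun k => weight k * bumpDeriv k t :=
  .of_norm_bounded (summable_const_mul_geometric 8) fun k => abs_weight_mul_bumpDeriv_le k t

/-- The tail is dominated by the geometric series of `8 * (3 / 4) ^ k`, whose ratio contributes the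
factor 4. -/
theorem abs_exponentDeriv_sub_le (n : ℕ) (t : ℝ) :
    |exponentDeriv t + -partialExponentDeriv n t| ≤ 32 * (3 / 4) ^ n := by
  have h1 : exponentDeriv t + -partialExponentDeriv n t =
      ∑' k, weight (k + n) * bumpDeriv (k + n) t := by
    rw [exponentDeriv, partialExponentDeriv,
      ← (summable_weight_mul_bumpDeriv t).sum_add_tsum_nat_add n]
    ring
  rw [h1]
  have hg : HasSum (fun k : ℕ => 8 * (3 / 4 : ℝ) ^ n * (3 / 4) ^ k) (32 * (3 / 4) ^ n) := by
    convert! (hasSum_geometric_of_lt_one (r := (3 / 4 : ℝ)) (by norm_num) (by norm_num)).mul_left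
      (8 * (3 / 4 : ℝ) ^ n) using 1
    norm_num
    ring
  refine tsum_of_norm_bounded (E := ℝ) hg fun k => ?_
  refine (abs_weight_mul_bumpDeriv_le (k + n) t).trans_eq ?_
  rw [pow_add]
  ring

theorem abs_exponentDeriv_le (t : ℝ) : |exponentDeriv t| ≤ 32 := by
  simpa [partialExponentDeriv] using abs_exponentDeriv_sub_le 0 t

theorem partialExponent_nonneg (n : ℕ) (t : ℝ) : 0 ≤ partialExponent n t :=
  Finset.sum_nonneg fun k _ => mul_nonneg (weight_pos k).le (bump_nonneg k t)

theorem exp_neg_partialExponent_le_one (n : ℕ) (t : ℝ) : Real.exp (-partialExponent n t) ≤ 1 :=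
  Real.exp_le_one_iff.2 (neg_nonpos.2 (partialExponent_nonneg n t))

theorem hasDerivAt_partialExponent (n : ℕ) (t : ℝ) :
    HasDerivAt (partialExponent n) (partialExponentDeriv n t) t :=
  HasDerivAt.fun_sum fun k _ => (hasDerivAt_bump k t).const_mul (weight k)

theorem continuous_partialExponent (n : ℕ) : Continuous (partialExponent n) :=
  continuous_finsetSum _ fun k _ => continuous_const.mul (continuous_bump k)

theorem continuous_partialExponentDeriv (n : ℕ) : Continuous (partialExponentDeriv n) :=
  continuous_finsetSum _ fun k _ => continuous_const.mul (continuous_bumpDeriv k)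

theorem abs_pulse (k : ℕ) (t : ℝ) :
    |pulse k t| = bump k t * Real.exp (-partialExponent k t) := by
  rw [pulse, abs_mul, abs_pow, abs_neg, abs_one, one_pow, one_mul,
    abs_of_nonneg (mul_nonneg (bump_nonneg k t) (Real.exp_pos _).le)]

theorem abs_pulse_le_bump (k : ℕ) (t : ℝ) : |pulse k t| ≤ bump k t := by
  rw [abs_pulse]
  exact mul_le_of_le_one_right (bump_nonneg k t) (exp_neg_partialExponent_le_one k t)

/-- With s the bump and w ≥ 1 its weight, e^{-ws} ≤ 1/(1+s) ≤ 1 - s/2 for 0 ≤ s ≤ 1. So s ≤ 2(1 -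
e^{-ws}), and multiplying by e^{-S_k} gives a telescoping majorant. -/
theorem abs_pulse_le_sub (k : ℕ) (t : ℝ) : |pulse k t| ≤
    2 * (Real.exp (-partialExponent k t) - Real.exp (-partialExponent (k + 1) t)) := by
  have hs := bump_nonneg k t
  have hs1 := bump_le_one k t
  have h1 : Real.exp (-(weight k * bump k t)) ≤ 1 - bump k t / 2 := by
    have h2 : 1 + bump k t ≤ Real.exp (weight k * bump k t) := by
      have := Real.add_one_le_exp (weight k * bump k t)
      nlinarith [one_le_weight k]
    rw [Real.exp_neg]
    refine (inv_anti₀ (by linarith) h2).trans ?_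
    rw [inv_le_iff_one_le_mul₀ (by linarith)]
    nlinarith
  have h3 : partialExponent (k + 1) t = partialExponent k t + weight k * bump k t :=
    Finset.sum_range_succ _ _
  rw [abs_pulse, h3, neg_add, Real.exp_add]
  nlinarith [Real.exp_pos (-partialExponent k t)]

theorem sum_abs_pulse_le (m n : ℕ) (t : ℝ) :
    ∑ k ∈ Finset.range n, |pulse (k + m) t| ≤ 2 * Real.exp (-partialExponent m t) := by
  have h : ∀ n, ∑ k ∈ Finset.range n, |pulse (k + m) t| ≤
      2 * (Real.exp (-partialExponent m t) - Real.exp (-partialExponent (n + m) t)) := by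
    intro n
    induction n with
    | zero => simp
    | succ n ih =>
      rw [Finset.sum_range_succ, add_right_comm]
      linarith [abs_pulse_le_sub (n + m) t]
  exact (h n).trans (by linarith [Real.exp_pos (-partialExponent (n + m) t)])

theorem summable_abs_pulse (m : ℕ) (t : ℝ) : Summable fun k => |pulse (k + m) t| :=
  summable_of_sum_range_le (fun _ => abs_nonneg _) fun n => sum_abs_pulse_le m n t

theorem summable_pulse (t : ℝ) : Summable fun k => pulse k t :=
  (summable_abs_pulse 0 t).of_abs

theorem abs_tsum_pulse_le (m : ℕ) (t : ℝ) :
    |∑' k, pulse (k + m) t| ≤ 2 * Real.exp (-partialExponent m t) :=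
  (tsum_of_norm_bounded (E := ℝ) (summable_abs_pulse m t).hasSum fun _ => le_rfl).trans
    ((summable_abs_pulse m t).tsum_le_of_sum_range_le fun n => sum_abs_pulse_le m n t)

theorem abs_pulseSum_le (t : ℝ) : |pulseSum t| ≤ 2 := by
  simpa [partialExponent, pulseSum] using abs_tsum_pulse_le 0 t

/-- Only the derivative of the bump and the tail of S' remain after the cancellation: 8 + 32 = 40.
-/
theorem abs_pulseDefect_le (k : ℕ) (t : ℝ) : |pulseDefect k t| ≤ 40 * (3 / 4) ^ k := by
  rw [pulseDefect, abs_mul, abs_mul, abs_pow, abs_neg, abs_one, one_pow, one_mul, Real.abs_exp]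
  refine (mul_le_of_le_one_left (abs_nonneg _) (exp_neg_partialExponent_le_one k t)).trans ?_
  refine (abs_add_le _ _).trans ?_
  rw [abs_mul, abs_of_nonneg (bump_nonneg k t)]
  have h1 := abs_exponentDeriv_sub_le k t
  have h2 := abs_bumpDeriv_le k t
  have h3 : (1 / 2 : ℝ) ^ k ≤ (3 / 4) ^ k :=
    pow_le_pow_left₀ (by norm_num) (by norm_num) k
  have h4 := mul_le_of_le_one_right (abs_nonneg (exponentDeriv t + -partialExponentDeriv k t))
    (bump_le_one k t)
  linarith

theorem continuous_pulseDefect (k : ℕ) : Continuous (pulseDefect k) := by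
  unfold pulseDefect
  have h1 := continuous_partialExponent k
  have h2 := continuous_bumpDeriv k
  have h3 := continuous_bump k
  have h4 := continuous_partialExponentDeriv k
  have h5 := continuous_exponentDeriv
  fun_prop

theorem continuous_forcing : Continuous forcing :=
  continuous_tsum continuous_pulseDefect (summable_const_mul_geometric 40) abs_pulseDefect_le

theorem hasDerivAt_pulse (k : ℕ) (t : ℝ) :
    HasDerivAt (pulse k) (-exponentDeriv t * pulse k t + pulseDefect k t) t := by
  refine (((hasDerivAt_bump k t).mul (hasDerivAt_partialExponent k t).neg.exp).const_mul
    ((-1) ^ k)).congr_deriv ?_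
  simp only [pulse, pulseDefect, Pi.neg_apply]
  ring

theorem hasDerivAt_pulseSum (t : ℝ) :
    HasDerivAt pulseSum (-exponentDeriv t * pulseSum t + forcing t) t := by
  -- The differentiated series is summed on a ball around 0 containing `t`, where the bumps are
  -- O(4^{-k}) uniformly; the pulses have no summable bound on the whole line.
  have hR : 0 < |t| + 1 := by positivity
  have := hasDerivAt_tsum_of_isPreconnected
    (summable_const_mul_geometric (512 * (|t| + 1) ^ 2 + 40)) Metric.isOpen_ball
    (convex_ball (0 : ℝ) (|t| + 1)).isPreconnected (fun k y _ => hasDerivAt_pulse k y) ?_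
    (Metric.mem_ball_self hR) (summable_pulse 0) (y := t) (by simp)
  · refine this.congr_deriv ?_
    rw [((summable_pulse t).mul_left _).tsum_add
      (.of_norm_bounded (summable_const_mul_geometric 40) fun k => abs_pulseDefect_le k t),
      tsum_mul_left]
    rfl
  · intro k y hy
    rw [mem_ball_zero_iff, Real.norm_eq_abs] at hy
    rw [Real.norm_eq_abs]
    refine (abs_add_le _ _).trans ?_
    rw [abs_mul, abs_neg, add_mul]
    refine add_le_add ?_ (abs_pulseDefect_le k y)
    have h1 : |pulse k y| ≤ 16 * (|t| + 1) ^ 2 * (3 / 4) ^ k := by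
      refine (abs_pulse_le_bump k y).trans ((bump_le k y).trans ?_)
      rw [← sq_abs y]
      gcongr
      norm_num
    calc |exponentDeriv y| * |pulse k y| ≤ 32 * (16 * (|t| + 1) ^ 2 * (3 / 4) ^ k) := by
          gcongr
          exact abs_exponentDeriv_le y
      _ = _ := by ring

theorem hasDerivAt_exp_neg_exponent (t : ℝ) : HasDerivAt (fun t => Real.exp (-exponent t))
    (-exponentDeriv t * Real.exp (-exponent t)) t :=
  (hasDerivAt_exponent t).neg.exp.congr_deriv (mul_comm _ _)

theorem weight_mul_bump_le_exponent (k : ℕ) (t : ℝ) : weight k * bump k t ≤ exponent t :=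
  (summable_weight_mul_bump t).le_tsum k fun j _ =>
    mul_nonneg (weight_pos j).le (bump_nonneg j t)

theorem exponent_nonneg (t : ℝ) : 0 ≤ exponent t :=
  (mul_nonneg (weight_pos 0).le (bump_nonneg 0 t)).trans (weight_mul_bump_le_exponent 0 t)

/-! ### Limit periodicity of the coefficients. -/

theorem dyadicLimitPeriodic_bump (k : ℕ) : DyadicLimitPeriodic (bump k) :=
  dyadicLimitPeriodic_of_periodic (periodic_bump k)

theorem dyadicLimitPeriodic_exponentDeriv : DyadicLimitPeriodic exponentDeriv :=
  .tsum (fun k => dyadicLimitPeriodic_of_periodic (m := k) fun t => by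
    rw [periodic_bumpDeriv k t]) (summable_const_mul_geometric 8) abs_weight_mul_bumpDeriv_le

theorem _root_.Function.Periodic.two_pow_of_le {g : ℝ → ℝ} {m n : ℕ}
    (hg : Function.Periodic g (2 ^ m)) (h : m ≤ n) : Function.Periodic g (2 ^ n) := by
  obtain ⟨k, rfl⟩ := Nat.exists_eq_add_of_le h
  have := hg.nat_mul (2 ^ k)
  push_cast at this
  rwa [pow_add, mul_comm]

theorem periodic_partialExponent (n : ℕ) : Function.Periodic (partialExponent n) (2 ^ n) := by
  intro t
  refine Finset.sum_congr rfl fun k hk => ?_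
  rw [(periodic_bump k).two_pow_of_le (Finset.mem_range.1 hk).le t]

theorem periodic_partialExponentDeriv (n : ℕ) :
    Function.Periodic (partialExponentDeriv n) (2 ^ n) := by
  intro t
  refine Finset.sum_congr rfl fun k hk => ?_
  rw [(periodic_bumpDeriv k).two_pow_of_le (Finset.mem_range.1 hk).le t]

theorem dyadicLimitPeriodic_pulseDefect (k : ℕ) : DyadicLimitPeriodic (pulseDefect k) := by
  have h1 : DyadicLimitPeriodic fun t => (-1) ^ k * Real.exp (-partialExponent k t) :=
    dyadicLimitPeriodic_of_periodic (m := k) fun t => by rw [periodic_partialExponent k t]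
  have h2 : DyadicLimitPeriodic fun t => exponentDeriv t + -partialExponentDeriv k t :=
    dyadicLimitPeriodic_exponentDeriv.add
      (dyadicLimitPeriodic_of_periodic (m := k) fun t => by rw [periodic_partialExponentDeriv k t])
  have h3 := h2.mul (dyadicLimitPeriodic_bump k) (abs_exponentDeriv_sub_le k)
    (D := 1) fun t => by rw [abs_of_nonneg (bump_nonneg k t)]; exact bump_le_one k t
  have h4 := (dyadicLimitPeriodic_of_periodic (periodic_bumpDeriv k)).add h3
  refine h1.mul h4 (C := 1) (D := 8 * (1 / 2) ^ k + 32 * (3 / 4) ^ k * 1) (fun t => ?_) fun t => ?_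
  · rw [abs_mul, abs_pow, abs_neg, abs_one, one_pow, one_mul, Real.abs_exp]
    exact exp_neg_partialExponent_le_one k t
  · refine (abs_add_le _ _).trans (add_le_add (abs_bumpDeriv_le k t) ?_)
    rw [abs_mul, abs_of_nonneg (bump_nonneg k t)]
    exact mul_le_mul (abs_exponentDeriv_sub_le k t) (bump_le_one k t) (bump_nonneg k t)
      (by positivity)

theorem dyadicLimitPeriodic_forcing : DyadicLimitPeriodic forcing :=
  .tsum dyadicLimitPeriodic_pulseDefect (summable_const_mul_geometric 40) abs_pulseDefect_le

/-! ### Values at differences of powers of two. -/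

theorem bump_sub_of_le {k m n : ℕ} (hk : k ≤ m) (hmn : m < n) :
    bump k ((2 : ℝ) ^ n - 2 ^ m) = 0 := by
  obtain ⟨i, rfl⟩ := Nat.exists_eq_add_of_le hk
  obtain ⟨j, rfl⟩ := Nat.exists_eq_add_of_lt hmn
  have : Real.pi * ((2 : ℝ) ^ (k + i + j + 1) - 2 ^ (k + i)) / 2 ^ k =
      ((2 ^ (i + j + 1) - 2 ^ i : ℤ) : ℝ) * Real.pi := by
    push_cast
    field_simp
    ring
  rw [bump, this, Real.sin_int_mul_pi]
  norm_num

/-- The point is an odd multiple of `2 ^ m`, half the period of this bump. -/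
theorem bump_sub_succ {m n : ℕ} (hmn : m < n) :
    bump (m + 1) ((2 : ℝ) ^ n - 2 ^ m) = 1 := by
  obtain ⟨j, rfl⟩ := Nat.exists_eq_add_of_lt hmn
  have : Real.pi * ((2 : ℝ) ^ (m + j + 1) - 2 ^ m) / 2 ^ (m + 1) =
      ((2 ^ j : ℕ) : ℝ) * Real.pi - Real.pi / 2 := by
    push_cast
    field_simp
    ring
  rw [bump, this, Real.sin_sub_pi_div_two, neg_sq, Real.cos_nat_mul_pi, ← pow_mul, mul_comm, pow_mul, neg_one_sq,
    one_pow]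

/-- The sum of pulses is close to `± 1` at `2 ^ n - 2 ^ m`. -/
theorem abs_pulseSum_sub_le {m n : ℕ} (hmn : m < n) :
    |pulseSum ((2 : ℝ) ^ n - 2 ^ m) - (-1) ^ (m + 1)| ≤ 2 * Real.exp (-weight (m + 1)) := by
  set d : ℝ := 2 ^ n - 2 ^ m with hd
  have hz : ∀ k ≤ m, bump k d = 0 := fun k hk => bump_sub_of_le hk hmn
  have ho : bump (m + 1) d = 1 := bump_sub_succ hmn
  have h0 : partialExponent (m + 1) d = 0 := Finset.sum_eq_zero fun k hk => by
    rw [hz k (Nat.lt_succ_iff.1 (Finset.mem_range.1 hk)), mul_zero]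
  have h1 : partialExponent (m + 2) d = weight (m + 1) := by
    have : partialExponent (m + 2) d = partialExponent (m + 1) d + weight (m + 1) * bump (m + 1) d :=
      Finset.sum_range_succ _ _
    rw [this, h0, ho, zero_add, mul_one]
  -- Only the pulse of index `m + 1` is nonzero here; the later ones are damped by `weight (m + 1)`,
  -- which has entered the exponent.
  have h2 : ∑ k ∈ Finset.range (m + 2), pulse k d = (-1) ^ (m + 1) := by
    rw [Finset.sum_range_succ, Finset.sum_eq_zero, pulse, ho, h0]
    · simp
    · intro k hk
      rw [pulse, hz k (Nat.lt_succ_iff.1 (Finset.mem_range.1 hk))]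
      simp
  rw [pulseSum, ← (summable_pulse d).sum_add_tsum_nat_add (m + 2), h2, add_sub_cancel_left, ← h1]
  exact abs_tsum_pulse_le (m + 2) d

theorem bump_zero (k : ℕ) : bump k 0 = 0 := by simp [bump]

theorem pulseSum_zero : pulseSum 0 = 0 := by simp [pulseSum, pulse, bump_zero]

theorem exponent_zero : exponent 0 = 0 := by simp [exponent, bump_zero]

/-! ### The Opial equation and its solutions. -/

theorem IsSolutionOn.uniformContinuous {f : C(ℝ × ℝ, ℝ)} {φ : ℝ → ℝ}
    (hf : AlmostPeriodicInTime f) (hφ : IsSolutionOn f univ φ) (hb : BoundedOn univ φ) :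
    UniformContinuous φ := by
  obtain ⟨C, hC⟩ := hb
  obtain ⟨M, hM⟩ := hf.exists_bound (isCompact_Icc (a := -C) (b := C))
  refine (LipschitzWith.of_dist_le' (K := M) fun r s => ?_).uniformContinuous
  exact convex_univ.norm_image_sub_le_of_norm_hasDerivWithin_le (fun x hx => hφ x hx)
    (fun x hx => hM x _ (abs_le.1 (hC x hx))) (mem_univ s) (mem_univ r)

/-- The right-hand side of a linear equation of Opial type. -/
noncomputable def opialField : C(ℝ × ℝ, ℝ) :=
  linearField ⟨fun t => -exponentDeriv t, continuous_exponentDeriv.neg⟩ ⟨forcing, continuous_forcing⟩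

theorem almostPeriodicInTime_opialField : AlmostPeriodicInTime opialField := by
  refine almostPeriodicInTime_linearField (fun ε hε => ?_) dyadicLimitPeriodic_forcing
  filter_upwards [dyadicLimitPeriodic_exponentDeriv ε hε] with n hn j t
  have := hn j t
  rwa [abs_sub_comm, ← neg_sub_neg] at this

theorem boundedOn_exp_neg_exponent : BoundedOn univ fun t => Real.exp (-exponent t) :=
  ⟨1, fun t _ => by
    rw [Real.abs_exp, Real.exp_le_one_iff, neg_nonpos]
    exact exponent_nonneg t⟩

theorem allSolutionsBounded_opialField : AllSolutionsBounded opialField :=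
  allSolutionsBounded_linearField hasDerivAt_exp_neg_exponent (fun _ => (Real.exp_pos _).ne')
    hasDerivAt_pulseSum boundedOn_exp_neg_exponent ⟨2, fun t _ => abs_pulseSum_le t⟩

theorem tendsto_exp_neg_weight : Tendsto (fun k => Real.exp (-weight k)) atTop (𝓝 0) :=
  Real.tendsto_exp_neg_atTop_nhds_zero.comp (tendsto_pow_atTop_atTop_of_one_lt (by norm_num))

/-- An almost periodic solution with coefficient `c` of the homogeneous part would have values
close to `c` at points where it is close to `1`, and also at points where it is close to `-1`. -/
theorem AlmostPeriodic.coeff_eq {φ : ℝ → ℝ} {c : ℝ} (hφ : AlmostPeriodic φ)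
    (hu : UniformContinuous φ) (hc : ∀ t, φ t = pulseSum t + c * Real.exp (-exponent t)) (p : ℕ) :
    c = (-1) ^ (p + 1) := by
  have hφ0 : φ 0 = c := by simp [hc, pulseSum_zero, exponent_zero]
  rw [← sub_eq_zero, ← abs_eq_zero]
  refine le_antisymm (le_of_forall_pos_le_add fun ε hε => ?_) (abs_nonneg _)
  have hpos : 0 < ε / 2 / (2 + |c|) := by positivity
  obtain ⟨N, hN⟩ := eventually_atTop.1 (tendsto_exp_neg_weight.eventually (gt_mem_nhds hpos))
  obtain ⟨m, hm, n, hn, h⟩ :=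
    -- Stepping the powers by two fixes the parity of the smaller exponent, hence the sign of the
    -- dominant pulse.
    hφ.exists_almostPeriod_sub hu (fun n => (2 : ℝ) ^ (2 * n + p)) (half_pos hε) N
  have hlt : 2 * m + p < 2 * n + p := by omega
  have hw := hN (2 * m + p + 1) (by omega)
  have hx := abs_pulseSum_sub_le hlt
  have he := weight_mul_bump_le_exponent (2 * m + p + 1) ((2 : ℝ) ^ (2 * n + p) - 2 ^ (2 * m + p))
  rw [bump_sub_succ hlt, mul_one] at he
  have h0 := h 0
  rw [zero_add, hφ0, hc] at h0
  have hs : (-1 : ℝ) ^ (2 * m + p + 1) = (-1) ^ (p + 1) := by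
    rw [add_assoc, pow_add, pow_mul, neg_one_sq, one_pow, one_mul]
  rw [hs] at hx
  rw [lt_div_iff₀ (by positivity)] at hw
  set d : ℝ := (2 : ℝ) ^ (2 * n + p) - 2 ^ (2 * m + p)
  have hce : |c * Real.exp (-exponent d)| ≤ |c| * Real.exp (-weight (2 * m + p + 1)) := by
    rw [abs_mul, Real.abs_exp]
    gcongr
  rw [abs_lt] at h0
  rw [abs_le] at hx hce ⊢
  constructor <;> linarith [h0.1, h0.2, hx.1, hx.2, hce.1, hce.2]

theorem isOpialEquation_opialField : IsOpialEquation opialField where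
  almostPeriodic := almostPeriodicInTime_opialField
  bounded := allSolutionsBounded_opialField
  not_almostPeriodic := by
    intro φ hφ hap
    have hu := hφ.uniformContinuous almostPeriodicInTime_opialField
      (allSolutionsBounded_opialField.2 φ hφ)
    obtain ⟨c, hc⟩ := IsSolutionOn.eq_add_mul ordConnected_univ hφ hasDerivAt_exp_neg_exponent
      (fun _ => (Real.exp_pos _).ne') hasDerivAt_pulseSum
    have h1 := hap.coeff_eq hu (fun t => hc t (mem_univ t)) 0
    have h2 := hap.coeff_eq hu (fun t => hc t (mem_univ t)) 1
    norm_num at h1 h2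
    linarith

theorem exponent_pos_of_abs_eq_one {t : ℝ} (ht : |t| = 1) : 0 < exponent t := by
  refine lt_of_lt_of_le ?_ (weight_mul_bump_le_exponent 1 t)
  have : bump 1 t = 1 := by
    rcases eq_or_eq_neg_of_abs_eq ht with rfl | rfl <;> simp [bump, neg_div]
  rw [this, mul_one]
  exact weight_pos 1

/-- A constant sign of the coefficient -S' would make S monotone, but S vanishes at 0 and is
positive at ±1; the point 1 serves here, and -1 for the antitone case. -/
theorem not_monotoneInState_opialField : ¬ MonotoneInState opialField := by
  intro h
  have hanti : Antitone exponent := antitone_of_hasDerivAt_nonpos hasDerivAt_exponent fun t => by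
    have := h t 0 1 zero_le_one
    simp only [opialField, linearField_apply, ContinuousMap.coe_mk, Pi.zero_apply] at this ⊢
    linarith
  have := hanti (zero_le_one' ℝ)
  rw [exponent_zero] at this
  exact this.not_gt (exponent_pos_of_abs_eq_one abs_one)

theorem not_antitoneInState_opialField : ¬ AntitoneInState opialField := by
  intro h
  have hmono : Monotone exponent := monotone_of_hasDerivAt_nonneg hasDerivAt_exponent fun t => by
    have := h t 0 1 zero_le_one
    simp only [opialField, linearField_apply, ContinuousMap.coe_mk, Pi.zero_apply] at this ⊢
    linarith
  have := hmono (neg_one_lt_zero (R := ℝ)).le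
  rw [exponent_zero] at this
  exact this.not_gt (exponent_pos_of_abs_eq_one (by simp))

end ScalarODE

theorem mainTheorem9 :
    (∀ f : C(ℝ × ℝ, ℝ), ScalarODE.IsOpialEquation f →
      (∀ φ : ℝ → ℝ, ScalarODE.IsSolutionOn f Set.univ φ → ¬ ScalarODE.RemotelyAlmostPeriodic φ) ∧
      (∀ φ : ℝ → ℝ, ScalarODE.IsSolutionOn f (Set.Ici 0) φ →
        ¬ ScalarODE.RemotelyAlmostPeriodic φ)) ∧
    (∃ f : C(ℝ × ℝ, ℝ), ScalarODE.IsOpialEquation f ∧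
      ¬ ScalarODE.MonotoneInState f ∧ ¬ ScalarODE.AntitoneInState f ∧
      ScalarODE.PositivelyLagrangeStable f ∧
      ScalarODE.RemotelyAlmostPeriodicInTime f ∧
      ScalarODE.IsMinimalSet (ScalarODE.omegaLimitSet f) ∧
      ScalarODE.IsRegular f ∧
      ∃ φ : ℝ → ℝ, ScalarODE.IsSolutionOn f (Set.Ici 0) φ ∧
        ScalarODE.BoundedOn (Set.Ici 0) φ ∧ ¬ ScalarODE.RemotelyAlmostPeriodic φ) := by
  open ScalarODE in
  have hap := almostPeriodicInTime_opialField
  have hsol : IsSolutionOn opialField univ pulseSum :=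
    isSolutionOn_univ_of_hasDerivAt hasDerivAt_pulseSum
  refine ⟨fun f hf => ⟨fun φ hφ => hf.not_remotelyAlmostPeriodic hφ,
    fun φ hφ => hf.not_remotelyAlmostPeriodic_Ici hφ⟩,
    opialField, isOpialEquation_opialField, not_monotoneInState_opialField,
    not_antitoneInState_opialField, hap.positivelyLagrangeStable, hap.remotely, ?_,
    isRegular_linearField _ _, pulseSum, fun t _ => (hsol.hasDerivAt t).hasDerivWithinAt,
    ⟨2, fun t _ => abs_pulseSum_le t⟩,
    isOpialEquation_opialField.not_remotelyAlmostPeriodic hsol⟩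
  rw [hap.omegaLimitSet_eq]
  exact hap.isMinimalSet_hull
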